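/- Let $\mathcal H$ be a real Hilbert space, let $R:\mathcal H\to\mathbb R\cup\{+\infty\}$ be proper, closed (lower semicontinuous) and convex, and let $F:\mathcal H\to\mathbb R$ be convex and differentiable with $L$-Lipschitz continuous gradient, $L>0$. Put $\Phi=R+F$ and assume $\operatorname{Argmin}(\Phi)\neq\emptyset$. For $\gamma>0$ let $$\operatorname{prox}_{\gamma R}(z)=\operatorname*{argmin}_{u\in\mathcal H}\ \tfrac12\|u-z\|^2+\gamma R(u).$$ Let $p\in\,]0,1[$ and $q>0$ with $p^2\le q$, let $\gamma=1/L$, $t_0=1$, $x_0\in\mathcal H$ arbitrary and $x_{-1}=x_0$. Consider FISTA-Mod with $r=4$, that is, the sequence defined by $$t_k=\frac{p+\sqrt{q+4t_{k-1}^2}}{2},\qquad a_k=\frac{t_{k-1}-1}{t_k}\qquad(k\ge1),$$ $$y_k=x_k+a_k(x_k-x_{k-1}),\qquad x_{k+1}=\operatorname{prox}_{\gamma R}\bigl(y_k-\gamma\nabla F(y_k)\bigr)\qquad(k\ge0),$$ where $y_0=x_0$ whatever the value of $a_0$, because $x_{-1}=x_0$. Then: (i) there exists $x^\star\in\operatorname{Argmin}(\Phi)$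 such that $(x_k)_{k\in\mathbb N}$ converges weakly to $x^\star$; (ii) $\|x_k-x_{k-1}\|=o(1/k)$ as $k\to\infty$. -/

import Mathlib

open Filter Topology Asymptotics
open scoped NNReal

noncomputable section

namespace FISTA

/-- `R : H → ℝ ∪ {+∞}` (as an `EReal`-valued function that never takes the value `-∞`)
is proper, closed (that is, lower semicontinuous) and convex. -/
structure ProperClosedConvex {H : Type*} [NormedAddCommGroup H] [InnerProductSpace ℝ H]
    (R : H → EReal) : Prop where
  ne_bot : ∀ x, R x ≠ ⊥
  exists_ne_top : ∃ x, R x ≠ ⊤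
  lsc : LowerSemicontinuous R
  convex : ∀ (x y : H) (a b : ℝ), 0 < a → 0 < b → a + b = 1 →
    R (a • x + b • y) ≤ (a : EReal) * R x + (b : EReal) * R y

/-- The composite objective `Φ = R + F`. -/
def objective {H : Type*} (R : H → EReal) (F : H → ℝ) (x : H) : EReal :=
  R x + (F x : EReal)

/-- The set of (global) minimizers of an extended-real-valued function. -/
def argmin {H : Type*} (Φ : H → EReal) : Set H :=
  {x | ∀ y, Φ x ≤ Φ y}

/-- The proximity operator `prox_{γR}(z)`: the minimizer of `u ↦ ½‖u - z‖² + γ R(u)`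
(it exists and is unique for proper closed convex `R` and `γ > 0`). -/
def prox {H : Type*} [NormedAddCommGroup H] [InnerProductSpace ℝ H]
    (γ : ℝ) (R : H → EReal) (z : H) : H :=
  Classical.epsilon fun u =>
    u ∈ argmin fun v => ((1 / 2 * ‖v - z‖ ^ 2 : ℝ) : EReal) + (γ : EReal) * R v

/-- `t₀ = 1`, `t_k = (p + √(q + r t_{k-1}²)) / 2` for `k ≥ 1`. -/
def tSeq (p q r : ℝ) : ℕ → ℝ
  | 0 => 1
  | k + 1 => (p + √(q + r * tSeq p q r k ^ 2)) / 2

/-- `a_k = (t_{k-1} - 1) / t_k` for `k ≥ 1`. The value of `a₀` plays no role, as it only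
multiplies `x₀ - x_{-1} = 0`. -/
def aSeq (p q r : ℝ) : ℕ → ℝ
  | 0 => 0
  | k + 1 => (tSeq p q r k - 1) / tSeq p q r (k + 1)

/-- The pair `(x_{k-1}, x_k)` of consecutive iterates of FISTA-Mod: `x_{-1} = x₀`,
`y_k = x_k + a_k (x_k - x_{k-1})`, `x_{k+1} = prox_{γR}(y_k - γ ∇F(y_k))`. -/
def modPair {H : Type*} [NormedAddCommGroup H] [InnerProductSpace ℝ H] [CompleteSpace H]
    (R : H → EReal) (F : H → ℝ) (γ p q r : ℝ) (x₀ : H) : ℕ → H × H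
  | 0 => (x₀, x₀)
  | k + 1 =>
    let u := (modPair R F γ p q r x₀ k).1
    let v := (modPair R F γ p q r x₀ k).2
    let y := v + aSeq p q r k • (v - u)
    (v, prox γ R (y - γ • gradient F y))

/-- The `k`-th iterate `x_k` of FISTA-Mod with step-size `γ`, parameters `p, q, r` and
starting point `x₀`. -/
def modIterate {H : Type*} [NormedAddCommGroup H] [InnerProductSpace ℝ H] [CompleteSpace H]
    (R : H → EReal) (F : H → ℝ) (γ p q r : ℝ) (x₀ : H) (k : ℕ) : H :=
  (modPair R F γ p q r x₀ k).2

end FISTA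

end

/-!
FISTA-Mod with `r = 4` has the exact recursion `t (k + 1) ^ 2 - t k ^ 2 = p * t (k + 1) + κ` with
`κ = (q - p ^ 2) / 4 ≥ 0`, so `t k` grows linearly and, as `p < 1`, the weight
`t k ^ 2 - t (k + 1) ^ 2 + t (k + 1)` eventually dominates a positive multiple of `t (k + 1)`. No
upper bound on `q` is needed: only finitely many indices are lost, and none of the limits sees them.

Let `T` be the proximal gradient step. Writing `Φ = R + F` and `M = min Φ`, convexity of `R`, the
descent lemma and the tangent inequality for `F` give
`2 / L * Φ (T y) + ‖T y - u‖ ^ 2 ≤ 2 / L * Φ u + ‖y - u‖ ^ 2` for every `u` (`proxGrad_estimate`).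
The proximal point exists because the step-size is `1 / L`: the function to be minimized is then
bounded below by a multiple of `M`, up to a constant, and strong convexity makes minimizing
sequences Cauchy.

Put `w n = 2 / L * (Φ (x (n + 1)) - M)` and `d n = ‖x (n + 1) - x n‖ ^ 2`. Testing the estimate at
a convex combination of `x (n + 1)` and a minimizer `s` (`energy_step`) shows that
`t n ^ 2 * w n + ‖v n‖ ^ 2` is eventually decreasing, where
`v n = x n - s + t n • (x (n + 1) - x n)`, and that `t (n + 1) * w n` is summable. Testing it at
`x (n + 1)` then shows that `t n ^ 2 * (w n + d n)` converges and that `t n * d n` is summable; since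
`∑ 1 / t n` diverges, the limit is zero (`tendsto_of_energy_estimates`). This is the rate
`‖x (n + 1) - x n‖ = o(1 / n)`. It also shows that `v n` and `x n - s` have the same asymptotic
norm, so `‖x n - s‖` converges for every minimizer `s`. As `w n` tends to zero and the sublevel sets
of `Φ` are closed and convex, hence weakly closed, weak limits along ultrafilters are minimizers,
and Opial's lemma (`exists_tendsto_toWeakSpace_of_opial`) gives weak convergence.
-/

namespace FISTA

/-! ### Real sequences -/

/-- A nonnegative sequence that decreases by at least `f n` at each step, up to a summable error
`g n`, converges, and its decrements `f n` are summable. -/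
lemma tendsto_and_summable_of_add_le_add {e f g : ℕ → ℝ} (he : ∀ n, 0 ≤ e n)
    (hf : ∀ n, 0 ≤ f n) (hg : ∀ n, 0 ≤ g n) (hgs : Summable g)
    (h : ∀ᶠ n in atTop, e (n + 1) + f n ≤ e n + g n) :
    (∃ l, Tendsto e atTop (𝓝 l)) ∧ Summable f := by
  obtain ⟨N, hN⟩ := eventually_atTop.1 h
  have hgs' : Summable fun n => g (n + N) := (summable_nat_add_iff N).2 hgs
  have key : ∀ n, e (n + N) + ∑ i ∈ Finset.range n, f (i + N)
      ≤ e N + ∑ i ∈ Finset.range n, g (i + N) := by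
    intro n
    induction n with
    | zero => simp
    | succ n ih =>
      rw [Finset.sum_range_succ, Finset.sum_range_succ]
      have := hN (n + N) (by omega)
      rw [show n + 1 + N = n + N + 1 by ring]
      linarith
  constructor
  · have hanti : Antitone fun n => e (n + N) - ∑ i ∈ Finset.range n, g (i + N) := by
      refine antitone_nat_of_succ_le fun n => ?_
      have := hN (n + N) (by omega)
      have := hf (n + N)
      simp only [Finset.sum_range_succ, show n + 1 + N = n + N + 1 by ring]
      linarith
    have hbdd : BddBelow (Set.range fun n => e (n + N) - ∑ i ∈ Finset.range n, g (i + N)) := by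
      refine ⟨-∑' i, g (i + N), ?_⟩
      rintro _ ⟨n, rfl⟩
      have := hgs'.sum_le_tsum (Finset.range n) fun i _ => hg (i + N)
      have := he (n + N)
      simp only
      linarith
    have h1 := (tendsto_atTop_ciInf hanti hbdd).add hgs'.hasSum.tendsto_sum_nat
    simp only [sub_add_cancel] at h1
    exact ⟨_, (tendsto_add_atTop_iff_nat (f := e) N).1 h1⟩
  · refine (summable_nat_add_iff N).1 (summable_of_sum_range_le (c := e N + ∑' i, g (i + N))
      (fun n => hf _) fun n => ?_)
    have := hgs'.sum_le_tsum (Finset.range n) fun i _ => hg (i + N)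
    have := he (n + N)
    have := key n
    linarith

/-- If a convergent nonnegative sequence is summable after division by a sequence of at most linear
growth, then its limit is zero, because the harmonic series diverges. -/
lemma tendsto_zero_of_summable_div {e t : ℕ → ℝ} {l C : ℝ} (he : ∀ n, 0 ≤ e n)
    (ht : ∀ n, 0 < t n) (htC : ∀ n, t n ≤ C * (n + 1)) (hl : Tendsto e atTop (𝓝 l))
    (hs : Summable fun n => e n / t n) : l = 0 := by
  by_contra hne
  have hl0 : 0 < l := lt_of_le_of_ne (ge_of_tendsto' hl he) (Ne.symm hne)
  have hC : 0 < C := by have := ht 0; have := htC 0; norm_num at this; linarith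
  obtain ⟨N, hN⟩ := eventually_atTop.1 (hl.eventually (lt_mem_nhds (half_lt_self hl0)))
  have h1 : Summable fun n : ℕ => (l / 2 / C) * (1 / (((n + N : ℕ) : ℝ) + 1)) := by
    refine Summable.of_nonneg_of_le (fun n => by positivity) (fun n => ?_)
      ((summable_nat_add_iff N).2 hs)
    rw [div_div, div_mul_div_comm, mul_one]
    have h2 := hN (n + N) (by omega)
    rw [div_le_div_iff₀ (by positivity) (ht _)]
    have h3 := htC (n + N)
    have h4 := ht (n + N)
    calc l * t (n + N) ≤ l * (C * (((n + N : ℕ) : ℝ) + 1)) := by gcongr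
      _ ≤ (2 * e (n + N)) * (C * (((n + N : ℕ) : ℝ) + 1)) := by gcongr; linarith
      _ = _ := by ring
  rw [summable_mul_left_iff (by positivity)] at h1
  have h2 := (summable_nat_add_iff (f := fun n : ℕ => 1 / ((n : ℝ) + 1)) N).1 h1
  have h3 := (summable_nat_add_iff (f := fun n : ℕ => 1 / (n : ℝ)) 1).1 (by simpa using h2)
  exact Real.not_summable_one_div_natCast h3

/-! ### The inertial parameters -/

section tSeq

variable {p q : ℝ}

lemma tSeq_succ_sq_sub (hq : 0 ≤ q) (n : ℕ) :
    tSeq p q 4 (n + 1) ^ 2 - tSeq p q 4 n ^ 2 = p * tSeq p q 4 (n + 1) + (q - p ^ 2) / 4 := by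
  simp only [tSeq]
  have := Real.sq_sqrt (show 0 ≤ q + 4 * tSeq p q 4 n ^ 2 by positivity)
  linear_combination this / 4

lemma le_tSeq (hp : 0 ≤ p) (hq : 0 ≤ q) (n : ℕ) : 1 + n * (p / 2) ≤ tSeq p q 4 n := by
  induction n with
  | zero => simp [tSeq]
  | succ n ih =>
    have h0 : 0 ≤ tSeq p q 4 n := le_trans (by positivity) ih
    have : 2 * tSeq p q 4 n ≤ √(q + 4 * tSeq p q 4 n ^ 2) :=
      Real.le_sqrt_of_sq_le (by nlinarith)
    simp only [tSeq]
    push_cast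
    linarith

lemma one_le_tSeq (hp : 0 ≤ p) (hq : 0 ≤ q) (n : ℕ) : 1 ≤ tSeq p q 4 n :=
  le_trans (le_add_of_nonneg_right (by positivity)) (le_tSeq hp hq n)

lemma tSeq_le (hp : 0 ≤ p) (hq : 0 ≤ q) (n : ℕ) :
    tSeq p q 4 n ≤ (1 + (p + √q) / 2) * (n + 1) := by
  have : tSeq p q 4 n ≤ 1 + n * ((p + √q) / 2) := by
    induction n with
    | zero => simp [tSeq]
    | succ n ih =>
      have h0 := one_le_tSeq hp hq n
      have : √(q + 4 * tSeq p q 4 n ^ 2) ≤ √q + 2 * tSeq p q 4 n := by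
        refine Real.sqrt_le_iff.2 ⟨by positivity, ?_⟩
        have := Real.sq_sqrt hq
        nlinarith [Real.sqrt_nonneg q, mul_nonneg (Real.sqrt_nonneg q) (zero_le_one.trans h0)]
      simp only [tSeq]
      push_cast
      linarith
  have h2 : 0 ≤ (p + √q) / 2 := by positivity
  nlinarith [(Nat.cast_nonneg n : (0 : ℝ) ≤ n)]

end tSeq

/-! ### Energy estimates -/

/-- The Lyapunov analysis of FISTA-Mod in terms of three nonnegative real sequences: `w` stands for
the (scaled) objective gap, `d` for the squared increments and `U` for the squared distance of the
extrapolated point to a minimizer. -/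
lemma tendsto_of_energy_estimates {p q : ℝ} (hp0 : 0 < p) (hp1 : p < 1) (hq : 0 ≤ q)
    (hpq : p ^ 2 ≤ q) {w d U : ℕ → ℝ} (hw : ∀ n, 0 ≤ w n) (hd : ∀ n, 0 ≤ d n)
    (hU : ∀ n, 0 ≤ U n)
    (h1 : ∀ n, tSeq p q 4 (n + 1) ^ 2 * w (n + 1) + U (n + 1)
      ≤ (tSeq p q 4 (n + 1) ^ 2 - tSeq p q 4 (n + 1)) * w n + U n)
    (h2 : ∀ n, tSeq p q 4 (n + 1) ^ 2 * (w (n + 1) + d (n + 1))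
      ≤ tSeq p q 4 (n + 1) ^ 2 * w n + (tSeq p q 4 n - 1) ^ 2 * d n) :
    Tendsto (fun n => tSeq p q 4 n ^ 2 * w n) atTop (𝓝 0) ∧
    Tendsto (fun n => tSeq p q 4 n ^ 2 * d n) atTop (𝓝 0) ∧
    ∃ l, Tendsto U atTop (𝓝 l) := by
  set t := tSeq p q 4 with ht
  set κ : ℝ := (q - p ^ 2) / 4 with hκ
  have hκ0 : 0 ≤ κ := by rw [hκ]; linarith
  have hrec : ∀ n, t (n + 1) ^ 2 - t n ^ 2 = p * t (n + 1) + κ := tSeq_succ_sq_sub hq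
  have ht1 : ∀ n, 1 ≤ t n := one_le_tSeq hp0.le hq
  have ht0 : ∀ n, 0 < t n := fun n => zero_lt_one.trans_le (ht1 n)
  -- Since `p < 1`, the loss `t (n + 1) - (t (n + 1) ^ 2 - t n ^ 2)` eventually dominates a positive
  -- multiple of `t (n + 1)`, whatever the size of `q`.
  have hlarge : ∀ᶠ n : ℕ in atTop, κ ≤ (1 - p) / 2 * t (n + 1) := by
    have : Tendsto (fun n : ℕ => (1 - p) / 2 * (((n : ℝ) + 1) * (p / 2))) atTop atTop :=
      ((tendsto_natCast_atTop_atTop.atTop_add tendsto_const_nhds).atTop_mul_const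
        (by positivity)).const_mul_atTop (by linarith)
    filter_upwards [this.eventually_ge_atTop κ] with n hn
    refine hn.trans (mul_le_mul_of_nonneg_left ?_ (by linarith))
    have := le_tSeq hp0.le hq (n + 1)
    push_cast at this
    linarith
  obtain ⟨⟨l₁, hl₁⟩, hs₁⟩ := tendsto_and_summable_of_add_le_add
    (e := fun n => t n ^ 2 * w n + U n) (f := fun n => (1 - p) / 2 * (t (n + 1) * w n))
    (g := fun _ => 0) (fun n => add_nonneg (mul_nonneg (sq_nonneg _) (hw n)) (hU n))
    (fun n => mul_nonneg (by linarith) (mul_nonneg (ht0 _).le (hw n))) (fun _ => le_rfl)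
    summable_zero (by
      filter_upwards [hlarge] with n hn
      have e1 : t (n + 1) ^ 2 - t (n + 1) ≤ t n ^ 2 - (1 - p) / 2 * t (n + 1) := by
        linarith [hrec n]
      have e2 := mul_le_mul_of_nonneg_right e1 (hw n)
      linarith [h1 n])
  rw [summable_mul_left_iff (by linarith)] at hs₁
  obtain ⟨⟨l₂, hl₂⟩, hs₂⟩ := tendsto_and_summable_of_add_le_add
    (e := fun n => t n ^ 2 * (w n + d n)) (f := fun n => t n * d n)
    (g := fun n => (p + κ) * (t (n + 1) * w n))
    (fun n => mul_nonneg (sq_nonneg _) (add_nonneg (hw n) (hd n)))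
    (fun n => mul_nonneg (ht0 _).le (hd n))
    (fun n => mul_nonneg (by linarith) (mul_nonneg (ht0 _).le (hw n)))
    (hs₁.mul_left _) (Eventually.of_forall fun n => by
      have e1 : t (n + 1) ^ 2 ≤ t n ^ 2 + (p + κ) * t (n + 1) := by
        nlinarith [hrec n, ht1 (n + 1)]
      have e2 := mul_le_mul_of_nonneg_right e1 (hw n)
      have e3 : (t n - 1) ^ 2 ≤ t n ^ 2 - t n := by nlinarith [ht1 n]
      have e4 := mul_le_mul_of_nonneg_right e3 (hd n)
      linarith [h2 n])
  have hmono : ∀ n, t n ≤ t (n + 1) := fun n => by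
    refine (sq_le_sq₀ (ht0 n).le (ht0 _).le).1 ?_
    have := mul_nonneg hp0.le (ht0 (n + 1)).le
    linarith [hrec n]
  have hl₂0 : l₂ = 0 := by
    refine tendsto_zero_of_summable_div
      (fun n => mul_nonneg (sq_nonneg (t n)) (add_nonneg (hw n) (hd n))) ht0
      (tSeq_le hp0.le hq) hl₂ ?_
    refine Summable.of_nonneg_of_le
      (fun n => div_nonneg (mul_nonneg (sq_nonneg _) (add_nonneg (hw n) (hd n))) (ht0 n).le)
      (fun n => ?_) (hs₁.add hs₂)
    have := mul_le_mul_of_nonneg_right (hmono n) (hw n)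
    rw [div_le_iff₀ (ht0 n)]
    nlinarith [mul_le_mul_of_nonneg_right this (ht0 n).le]
  subst hl₂0
  have hw0 : Tendsto (fun n => t n ^ 2 * w n) atTop (𝓝 0) :=
    squeeze_zero (fun n => mul_nonneg (sq_nonneg _) (hw n))
      (fun n => mul_le_mul_of_nonneg_left (le_add_of_nonneg_right (hd n)) (sq_nonneg _)) hl₂
  refine ⟨hw0, ?_, l₁, ?_⟩
  · exact squeeze_zero (fun n => mul_nonneg (sq_nonneg _) (hd n))
      (fun n => mul_le_mul_of_nonneg_left (le_add_of_nonneg_left (hw n)) (sq_nonneg _)) hl₂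
  · simpa using hl₁.sub hw0

variable {H : Type*} [NormedAddCommGroup H] [InnerProductSpace ℝ H]

/-! ### Smooth convex functions -/

section Smooth

variable [CompleteSpace H] {F : H → ℝ}

lemma hasDerivAt_comp_add_smul (hF : Differentiable ℝ F) (y v : H) (s : ℝ) :
    HasDerivAt (fun s : ℝ => F (y + s • v)) (inner ℝ (gradient F (y + s • v)) v) s := by
  have h1 : HasDerivAt (fun s : ℝ => y + s • v) v s := by
    simpa using ((hasDerivAt_id s).smul_const v).const_add y
  have h2 := (hF (y + s • v)).hasGradientAt.hasFDerivAt.comp_hasDerivAt s h1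
  rwa [InnerProductSpace.toDual_apply_apply] at h2

/-- A differentiable convex function lies above its tangent planes. -/
lemma add_inner_gradient_le (hconv : ConvexOn ℝ Set.univ F) (hF : Differentiable ℝ F) (y u : H) :
    F y + inner ℝ (gradient F y) (u - y) ≤ F u := by
  have hg : ConvexOn ℝ Set.univ fun s : ℝ => F (y + s • (u - y)) := by
    have := hconv.comp_affineMap (AffineMap.lineMap (k := ℝ) y u)
    rw [Set.preimage_univ] at this
    refine this.congr fun s _ => ?_
    simp [AffineMap.lineMap_apply, add_comm]
  have := hg.le_slope_of_hasDerivAt (Set.mem_univ 0) (Set.mem_univ 1) one_pos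
    (hasDerivAt_comp_add_smul hF y (u - y) 0)
  simp only [slope_def_field, zero_smul, add_zero, one_smul, add_sub_cancel, sub_zero,
    div_one] at this
  linarith

/-- The descent lemma for functions with Lipschitz gradient. -/
lemma le_add_inner_gradient_add_sq {L : ℝ≥0} (hF : Differentiable ℝ F)
    (hlip : LipschitzWith L (gradient F)) (y u : H) :
    F u ≤ F y + inner ℝ (gradient F y) (u - y) + L / 2 * ‖u - y‖ ^ 2 := by
  have hB : ∀ s : ℝ, HasDerivAt
      (fun s : ℝ => F y + s * inner ℝ (gradient F y) (u - y) + L / 2 * s ^ 2 * ‖u - y‖ ^ 2)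
      (inner ℝ (gradient F y) (u - y) + L * s * ‖u - y‖ ^ 2) s := by
    intro s
    have h1 := ((hasDerivAt_id s).mul_const (inner ℝ (gradient F y) (u - y))).const_add (F y)
    have h2 := (((hasDerivAt_id s).pow 2).const_mul ((L : ℝ) / 2)).mul_const (‖u - y‖ ^ 2)
    refine (h1.add h2).congr_deriv ?_
    simp only [id_eq, pow_one, Nat.cast_ofNat, Nat.add_one_sub_one]
    ring
  have h := image_le_of_deriv_right_le_deriv_boundary (a := 0) (b := 1)
    (f := fun s : ℝ => F (y + s • (u - y)))
    (fun s _ => (hasDerivAt_comp_add_smul hF y (u - y) s).continuousAt.continuousWithinAt)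
    (fun s _ => (hasDerivAt_comp_add_smul hF y (u - y) s).hasDerivWithinAt)
    (by simp) (fun s _ => (hB s).continuousAt.continuousWithinAt)
    (fun s _ => (hB s).hasDerivWithinAt)
    (fun s hs => by
      have h1 : inner ℝ (gradient F (y + s • (u - y)) - gradient F y) (u - y)
          ≤ L * s * ‖u - y‖ * ‖u - y‖ := by
        refine (real_inner_le_norm _ _).trans (mul_le_mul_of_nonneg_right ?_ (norm_nonneg _))
        have := hlip.norm_sub_le (y + s • (u - y)) y
        rw [add_sub_cancel_left, norm_smul, Real.norm_of_nonneg hs.1] at this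
        linarith
      rw [inner_sub_left] at h1
      nlinarith)
    (show (1 : ℝ) ∈ Set.Icc 0 1 by simp)
  simpa using h

end Smooth

/-! ### Extended-valued convex functions -/

namespace ProperClosedConvex

variable {R : H → EReal}

lemma coe_toReal (hR : ProperClosedConvex R) {x : H} (hx : R x ≠ ⊤) :
    ((R x).toReal : EReal) = R x :=
  EReal.coe_toReal hx (hR.ne_bot x)

/-- Convexity in terms of upper bounds: a convex combination of points at which `R` is bounded by
real numbers. -/
lemma convexComb_le (hR : ProperClosedConvex R) {x y : H} {r s a b : ℝ} (hx : R x ≤ r)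
    (hy : R y ≤ s) (ha : 0 ≤ a) (hb : 0 ≤ b) (hab : a + b = 1) :
    R (a • x + b • y) ≤ ((a * r + b * s : ℝ) : EReal) := by
  rcases ha.eq_or_lt with rfl | ha
  · obtain rfl : b = 1 := by linarith
    simpa using hy
  rcases hb.eq_or_lt with rfl | hb
  · obtain rfl : a = 1 := by linarith
    simpa using hx
  refine (hR.convex x y a b ha hb hab).trans ?_
  push_cast
  exact add_le_add (mul_le_mul_of_nonneg_left hx (by exact_mod_cast ha.le))
    (mul_le_mul_of_nonneg_left hy (by exact_mod_cast hb.le))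

/-- Lower semicontinuity in terms of upper bounds along a sequence. -/
lemma le_of_tendsto (hR : ProperClosedConvex R) {ι : Type*} {l : Filter ι} [l.NeBot]
    {u : ι → H} {c : ι → ℝ} {u₀ : H} {c₀ : ℝ} (hu : Tendsto u l (𝓝 u₀))
    (hc : Tendsto c l (𝓝 c₀)) (h : ∀ n, R (u n) ≤ c n) : R u₀ ≤ c₀ := by
  refine EReal.le_of_forall_lt_iff_le.1 fun z hz => ?_
  have hz' : c₀ < z := by exact_mod_cast hz
  refine (hR.lsc.isClosed_preimage (z : EReal)).mem_of_tendsto hu ?_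
  filter_upwards [hc.eventually (gt_mem_nhds hz')] with n hn
  exact (h n).trans (by exact_mod_cast hn.le)

end ProperClosedConvex

/-! ### The proximity operator -/

/-- A proper closed convex function plus a quadratic has a minimizer once it is bounded below:
by strong convexity, minimizing sequences are Cauchy. -/
lemma exists_mem_argmin_prox [CompleteSpace H] {R : H → EReal} (hR : ProperClosedConvex R) {γ : ℝ}
    (hγ : 0 < γ) {z : H} {m : ℝ}
    (hm : ∀ (u : H) (r : ℝ), R u ≤ r → m ≤ 1 / 2 * ‖u - z‖ ^ 2 + γ * r) :
    ∃ u, R u ≠ ⊤ ∧ ∀ (v : H) (r : ℝ), R v ≤ r →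
      1 / 2 * ‖u - z‖ ^ 2 + γ * (R u).toReal ≤ 1 / 2 * ‖v - z‖ ^ 2 + γ * r := by
  set S : Set ℝ := {c | ∃ (u : H) (r : ℝ), R u ≤ r ∧ c = 1 / 2 * ‖u - z‖ ^ 2 + γ * r} with hS
  have hSne : S.Nonempty := by
    obtain ⟨x, hx⟩ := hR.exists_ne_top
    exact ⟨_, x, (R x).toReal, (hR.coe_toReal hx).ge, rfl⟩
  have hSb : BddBelow S := ⟨m, by rintro _ ⟨u, r, hu, rfl⟩; exact hm u r hu⟩
  have hinf : ∀ (u : H) (r : ℝ), R u ≤ r → sInf S ≤ 1 / 2 * ‖u - z‖ ^ 2 + γ * r :=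
    fun u r hu => csInf_le hSb ⟨u, r, hu, rfl⟩
  have hseq : ∀ n : ℕ, ∃ (u : H) (r : ℝ), R u ≤ r ∧
      1 / 2 * ‖u - z‖ ^ 2 + γ * r < sInf S + 1 / ((n : ℝ) + 1) := by
    intro n
    obtain ⟨_, ⟨u, r, hu, rfl⟩, h⟩ := exists_lt_of_csInf_lt hSne
      (show sInf S < sInf S + 1 / ((n : ℝ) + 1) from lt_add_of_pos_right _ (by positivity))
    exact ⟨u, r, hu, h⟩
  choose u r hur hlt using hseq
  have hcauchy : CauchySeq u := by
    have hbound : ∀ i j N : ℕ, N ≤ i → N ≤ j → dist (u i) (u j) ≤ √(8 * (1 / ((N : ℝ) + 1))) := by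
      intro i j N hi hj
      refine Real.le_sqrt_of_sq_le ?_
      have h1 := hinf _ _ (hR.convexComb_le (hur i) (hur j) (a := 1 / 2) (b := 1 / 2)
        (by norm_num) (by norm_num) (by norm_num))
      -- The parallelogram identity at the midpoint.
      have h2 : ‖(1 / 2 : ℝ) • u i + (1 / 2 : ℝ) • u j - z‖ ^ 2
          = 1 / 2 * ‖u i - z‖ ^ 2 + 1 / 2 * ‖u j - z‖ ^ 2 - 1 / 4 * ‖u i - u j‖ ^ 2 := by
        have e1 : (1 / 2 : ℝ) • u i + (1 / 2 : ℝ) • u j - z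
            = (1 / 2 : ℝ) • ((u i - z) + (u j - z)) := by module
        have e2 : u i - u j = (u i - z) - (u j - z) := by abel
        rw [e1, e2, norm_smul, mul_pow, norm_add_sq_real, norm_sub_sq_real (u i - z)]
        norm_num
        ring
      have h3 : 1 / ((i : ℝ) + 1) ≤ 1 / ((N : ℝ) + 1) := by gcongr
      have h4 : 1 / ((j : ℝ) + 1) ≤ 1 / ((N : ℝ) + 1) := by gcongr
      rw [dist_eq_norm]
      linarith [hlt i, hlt j]
    refine cauchySeq_of_le_tendsto_0' (fun N : ℕ => √(8 * (1 / ((N : ℝ) + 1))))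
      (fun N j h => hbound N j N le_rfl h) ?_
    have := (tendsto_one_div_add_atTop_nhds_zero_nat (𝕜 := ℝ)).const_mul 8
    rw [mul_zero] at this
    have h := (Real.continuous_sqrt.tendsto 0).comp this
    rwa [Real.sqrt_zero] at h
  obtain ⟨u₀, hu₀⟩ := cauchySeq_tendsto_of_complete hcauchy
  have hR₀ : R u₀ ≤ (((sInf S - 1 / 2 * ‖u₀ - z‖ ^ 2) / γ : ℝ) : EReal) := by
    refine hR.le_of_tendsto (c := fun n : ℕ =>
      (sInf S + 1 / ((n : ℝ) + 1) - 1 / 2 * ‖u n - z‖ ^ 2) / γ) hu₀ ?_ fun n => ?_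
    · have h1 := ((hu₀.sub_const z).norm.pow 2).const_mul (1 / 2)
      have h2 := (tendsto_one_div_add_atTop_nhds_zero_nat (𝕜 := ℝ)).const_add (sInf S)
      simpa using (h2.sub h1).div_const γ
    · refine (hur n).trans (EReal.coe_le_coe_iff.2 ?_)
      rw [le_div_iff₀ hγ]
      linarith [hlt n]
  have htop : R u₀ ≠ ⊤ := ne_top_of_le_ne_top (EReal.coe_ne_top _) hR₀
  refine ⟨u₀, htop, fun v s hv => le_trans ?_ (hinf v s hv)⟩
  rw [← hR.coe_toReal htop, EReal.coe_le_coe_iff, le_div_iff₀ hγ] at hR₀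
  linarith

/-- The variational inequality characterizing the proximity operator, in the presence of the lower
bound that makes the proximity operator well defined. -/
lemma prox_ne_top_and_inequality [CompleteSpace H] {R : H → EReal} (hR : ProperClosedConvex R)
    {γ : ℝ} (hγ : 0 < γ) {z : H} {m : ℝ}
    (hm : ∀ (u : H) (r : ℝ), R u ≤ r → m ≤ 1 / 2 * ‖u - z‖ ^ 2 + γ * r) :
    R (prox γ R z) ≠ ⊤ ∧ ∀ (u : H) (r : ℝ), R u ≤ r →
      γ * (R (prox γ R z)).toReal + inner ℝ (prox γ R z - z) (prox γ R z - u) ≤ γ * r := by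
  obtain ⟨u₀, htop₀, hu₀⟩ := exists_mem_argmin_prox hR hγ hm
  have hval : ∀ v : H, R v ≠ ⊤ →
      ((1 / 2 * ‖v - z‖ ^ 2 : ℝ) : EReal) + (γ : EReal) * R v
        = ((1 / 2 * ‖v - z‖ ^ 2 + γ * (R v).toReal : ℝ) : EReal) := fun v hv => by
    conv_lhs => rw [← hR.coe_toReal hv]
    push_cast
    rfl
  have hval_top : ∀ v : H, R v = ⊤ →
      ((1 / 2 * ‖v - z‖ ^ 2 : ℝ) : EReal) + (γ : EReal) * R v = ⊤ := fun v hv => by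
    rw [hv, EReal.coe_mul_top_of_pos hγ, EReal.coe_add_top]
  have hmem : prox γ R z ∈ argmin fun v =>
      ((1 / 2 * ‖v - z‖ ^ 2 : ℝ) : EReal) + (γ : EReal) * R v := by
    refine Classical.epsilon_spec
      (p := fun u => u ∈ argmin fun v =>
        ((1 / 2 * ‖v - z‖ ^ 2 : ℝ) : EReal) + (γ : EReal) * R v) ⟨u₀, fun v => ?_⟩
    simp only
    by_cases hv : R v = ⊤
    · rw [hval_top v hv]; exact le_top
    · rw [hval v hv, hval u₀ htop₀, EReal.coe_le_coe_iff]
      exact hu₀ v _ (hR.coe_toReal hv).ge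
  set P := prox γ R z with hP
  have htop : R P ≠ ⊤ := by
    intro h
    have := hmem u₀
    simp only at this
    rw [hval_top P h, hval u₀ htop₀, top_le_iff] at this
    exact EReal.coe_ne_top _ this
  have hminP : ∀ (u : H) (r : ℝ), R u ≤ r →
      1 / 2 * ‖P - z‖ ^ 2 + γ * (R P).toReal ≤ 1 / 2 * ‖u - z‖ ^ 2 + γ * r := by
    intro u r hu
    have hu_top : R u ≠ ⊤ := ne_top_of_le_ne_top (EReal.coe_ne_top _) hu
    have := hmem u
    simp only at this
    rw [hval P htop, hval u hu_top, EReal.coe_le_coe_iff] at this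
    rw [← hR.coe_toReal hu_top, EReal.coe_le_coe_iff] at hu
    linarith [mul_le_mul_of_nonneg_left hu hγ.le]
  refine ⟨htop, fun u r hu => ?_⟩
  -- Compare `P` with the points `P + θ • (u - P)`, divide by `θ` and let `θ` tend to zero.
  have hθ : ∀ θ ∈ Set.Ioo (0 : ℝ) 1,
      γ * (R P).toReal + inner ℝ (P - z) (P - u) ≤ γ * r + θ / 2 * ‖u - P‖ ^ 2 := by
    intro θ hθ
    have h1 := hminP _ _ (hR.convexComb_le (hR.coe_toReal htop).ge hu (a := 1 - θ) (b := θ)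
      (by linarith [hθ.2]) hθ.1.le (by ring))
    have h2 : ‖(1 - θ) • P + θ • u - z‖ ^ 2
        = ‖P - z‖ ^ 2 - 2 * θ * inner ℝ (P - z) (P - u) + θ ^ 2 * ‖u - P‖ ^ 2 := by
      have e1 : (1 - θ) • P + θ • u - z = (P - z) - θ • (P - u) := by module
      rw [e1, norm_sub_sq_real, norm_smul, inner_smul_right, norm_sub_rev u P, mul_pow,
        Real.norm_eq_abs, sq_abs]
      ring
    rw [h2] at h1
    refine le_of_mul_le_mul_left ?_ hθ.1
    nlinarith
  have hlim : Tendsto (fun θ : ℝ => γ * r + θ / 2 * ‖u - P‖ ^ 2) (𝓝[>] 0) (𝓝 (γ * r)) := by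
    have : Continuous fun θ : ℝ => γ * r + θ / 2 * ‖u - P‖ ^ 2 := by fun_prop
    simpa using (this.tendsto 0).mono_left nhdsWithin_le_nhds
  refine ge_of_tendsto hlim ?_
  filter_upwards [Ioo_mem_nhdsGT (zero_lt_one' ℝ)] with θ h
  exact hθ θ h

/-! ### The proximal gradient step -/

/-- The basic estimate for a proximal gradient step with step-size `1 / L`. The lower bound `M` on
`R + F` is only used to ensure that the proximity operator is well defined: with this step-size
the function that it minimizes at a gradient step majorizes `1 / L` times `R + F`, up to a
constant. -/
lemma proxGrad_estimate [CompleteSpace H] {R : H → EReal} {F : H → ℝ} {L : ℝ≥0}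
    (hR : ProperClosedConvex R) (hFconv : ConvexOn ℝ Set.univ F) (hFdiff : Differentiable ℝ F)
    (hL : 0 < L) (hFlip : LipschitzWith L (gradient F)) {M : ℝ}
    (hM : ∀ (u : H) (r : ℝ), R u ≤ r → M ≤ r + F u) (y : H) {P : H}
    (hP : P = prox (1 / (L : ℝ)) R (y - (1 / (L : ℝ)) • gradient F y)) :
    R P ≠ ⊤ ∧ ∀ (u : H) (r : ℝ), R u ≤ r →
      2 / L * ((R P).toReal + F P) + ‖P - u‖ ^ 2 ≤ 2 / L * (r + F u) + ‖y - u‖ ^ 2 := by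
  have hL' : (0 : ℝ) < L := by exact_mod_cast hL
  set γ : ℝ := 1 / (L : ℝ) with hγ
  have hγ0 : 0 < γ := by positivity
  have hγL : γ * L = 1 := by rw [hγ]; field_simp
  set G := gradient F y with hG
  -- The descent lemma, scaled by the step-size.
  have hdesc : ∀ u : H, γ * F u ≤ γ * F y + γ * inner ℝ G (u - y) + 1 / 2 * ‖u - y‖ ^ 2 := by
    intro u
    have := mul_le_mul_of_nonneg_left (le_add_inner_gradient_add_sq hFdiff hFlip y u) hγ0.le
    linear_combination this + 1 / 2 * ‖u - y‖ ^ 2 * hγL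
  have hsq : ∀ u : H, ‖u - (y - γ • G)‖ ^ 2
      = ‖u - y‖ ^ 2 + 2 * γ * inner ℝ G (u - y) + γ ^ 2 * ‖G‖ ^ 2 := by
    intro u
    rw [show u - (y - γ • G) = (u - y) + γ • G by abel, norm_add_sq_real, norm_smul,
      inner_smul_right, mul_pow, Real.norm_eq_abs, sq_abs, real_inner_comm]
    ring
  obtain ⟨htop, hvar⟩ := prox_ne_top_and_inequality hR hγ0 (z := y - γ • G)
    (m := γ * M - γ * F y + 1 / 2 * (γ ^ 2 * ‖G‖ ^ 2)) (fun u r hu => by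
      have h1 := mul_le_mul_of_nonneg_left (hM u r hu) hγ0.le
      linarith [hdesc u, hsq u])
  rw [← hP] at htop hvar
  refine ⟨htop, fun u r hu => ?_⟩
  have h1 := hvar u r hu
  have h2 := hdesc P
  have h3 := mul_le_mul_of_nonneg_left (add_inner_gradient_le hFconv hFdiff y u) hγ0.le
  have h4 : inner ℝ (P - (y - γ • G)) (P - u)
      = inner ℝ (P - y) (P - u) + γ * (inner ℝ G (P - y) - inner ℝ G (u - y)) := by
    rw [show P - (y - γ • G) = (P - y) + γ • G by abel, inner_add_left, inner_smul_left,
      ← inner_sub_right, show P - y - (u - y) = P - u by abel]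
    simp
  have h5 : ‖y - u‖ ^ 2 = ‖P - u‖ ^ 2 - 2 * inner ℝ (P - y) (P - u) + ‖P - y‖ ^ 2 := by
    rw [show y - u = (P - u) - (P - y) by abel, norm_sub_sq_real, real_inner_comm]
  have h6 : (2 : ℝ) / L = 2 * γ := by rw [hγ]; ring
  rw [h6]
  linarith

/-! ### Weak convergence -/

lemma tendsto_toWeakSpace_iff_inner [CompleteSpace H] {ι : Type*} {l : Filter ι} {x : ι → H}
    {a : H} : Tendsto (fun i => toWeakSpace ℝ H (x i)) l (𝓝 (toWeakSpace ℝ H a)) ↔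
      ∀ v : H, Tendsto (fun i => inner ℝ v (x i)) l (𝓝 (inner ℝ v a)) := by
  have hinj : Function.Injective (topDualPairing ℝ H).flip := fun u v h =>
    ext_inner_left ℝ fun w => LinearMap.congr_fun h (innerSL ℝ w)
  refine (WeakBilin.tendsto_iff_forall_eval_tendsto (topDualPairing ℝ H).flip hinj).trans ?_
  constructor
  · intro h v
    exact h (innerSL ℝ v)
  · intro h f
    have := h ((InnerProductSpace.toDual ℝ H).symm f)
    simp only [InnerProductSpace.toDual_symm_apply] at this
    exact this

/-- Bounded sequences in a Hilbert space converge weakly along ultrafilters. -/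
lemma exists_tendsto_toWeakSpace_of_bounded [CompleteSpace H] {ι : Type*} (𝒰 : Ultrafilter ι)
    {x : ι → H} {C : ℝ} (hx : ∀ i, ‖x i‖ ≤ C) :
    ∃ a : H, Tendsto (fun i => toWeakSpace ℝ H (x i)) 𝒰 (𝓝 (toWeakSpace ℝ H a)) := by
  let φ : ι → WeakDual ℝ H := fun i => StrongDual.toWeakDual (InnerProductSpace.toDual ℝ H (x i))
  have hmem : ∀ i, φ i ∈ WeakDual.toStrongDual ⁻¹' Metric.closedBall (0 : StrongDual ℝ H) C := by
    intro i
    simpa [φ] using hx i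
  obtain ⟨f, -, hf⟩ := (WeakDual.isCompact_closedBall (0 : StrongDual ℝ H) C).ultrafilter_le_nhds
    (𝒰.map φ) (by
      rw [le_principal_iff]
      exact Ultrafilter.mem_map.2 (Filter.univ_mem' hmem))
  refine ⟨(InnerProductSpace.toDual ℝ H).symm (WeakDual.toStrongDual f),
    tendsto_toWeakSpace_iff_inner.2 fun v => ?_⟩
  have h1 : Tendsto (fun i => φ i v) 𝒰 (𝓝 (f v)) :=
    ((WeakDual.eval_continuous v).tendsto f).comp hf
  rw [real_inner_comm, InnerProductSpace.toDual_symm_apply]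
  refine h1.congr fun i => ?_
  exact real_inner_comm _ _

/-- Opial's lemma: if the distance to each point of `S` converges, and all weak limits along
ultrafilters lie in `S`, then the sequence converges weakly to a point of `S`. -/
lemma exists_tendsto_toWeakSpace_of_opial [CompleteSpace H] {x : ℕ → H} {S : Set H}
    (hne : S.Nonempty) (hdist : ∀ a ∈ S, ∃ l, Tendsto (fun k => ‖x k - a‖ ^ 2) atTop (𝓝 l))
    (hlim : ∀ (𝒰 : Ultrafilter ℕ) (a : H), ↑𝒰 ≤ (atTop : Filter ℕ) →
      Tendsto (fun k => toWeakSpace ℝ H (x k)) 𝒰 (𝓝 (toWeakSpace ℝ H a)) → a ∈ S) :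
    ∃ a ∈ S, Tendsto (fun k => toWeakSpace ℝ H (x k)) atTop (𝓝 (toWeakSpace ℝ H a)) := by
  obtain ⟨C, hC⟩ : ∃ C, ∀ k, ‖x k‖ ≤ C := by
    obtain ⟨s, hs⟩ := hne
    obtain ⟨l, hl⟩ := hdist s hs
    obtain ⟨B, hB⟩ := hl.bddAbove_range
    refine ⟨√B + ‖s‖, fun k => ?_⟩
    have h1 : ‖x k - s‖ ≤ √B := Real.le_sqrt_of_sq_le (hB ⟨k, rfl⟩)
    have h2 := norm_add_le (x k - s) s
    rw [sub_add_cancel] at h2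
    linarith
  have hcl : ∀ 𝒰 : Ultrafilter ℕ, ↑𝒰 ≤ (atTop : Filter ℕ) → ∃ a ∈ S,
      Tendsto (fun k => toWeakSpace ℝ H (x k)) 𝒰 (𝓝 (toWeakSpace ℝ H a)) := fun 𝒰 h𝒰 => by
    obtain ⟨a, ha⟩ := exists_tendsto_toWeakSpace_of_bounded 𝒰 hC
    exact ⟨a, hlim 𝒰 a h𝒰 ha, ha⟩
  -- Two weak limits `a` and `b` agree because `⟪a - b, x k⟫` converges.
  have huniq : ∀ a ∈ S, ∀ b ∈ S, ∀ 𝒰 𝒱 : Ultrafilter ℕ, ↑𝒰 ≤ (atTop : Filter ℕ) →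
      ↑𝒱 ≤ (atTop : Filter ℕ) →
      Tendsto (fun k => toWeakSpace ℝ H (x k)) 𝒰 (𝓝 (toWeakSpace ℝ H a)) →
      Tendsto (fun k => toWeakSpace ℝ H (x k)) 𝒱 (𝓝 (toWeakSpace ℝ H b)) → a = b := by
    intro a ha b hb 𝒰 𝒱 h𝒰 h𝒱 hxa hxb
    obtain ⟨la, hla⟩ := hdist a ha
    obtain ⟨lb, hlb⟩ := hdist b hb
    have h1 : Tendsto (fun k => inner ℝ (a - b) (x k)) atTop
        (𝓝 ((lb - la + ‖a‖ ^ 2 - ‖b‖ ^ 2) / 2)) := by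
      refine ((((hlb.sub hla).add_const (‖a‖ ^ 2)).sub_const (‖b‖ ^ 2)).div_const 2).congr
        fun k => ?_
      rw [norm_sub_sq_real, norm_sub_sq_real, inner_sub_left, real_inner_comm a, real_inner_comm b]
      ring
    have h2 := tendsto_nhds_unique (h1.mono_left h𝒰) (tendsto_toWeakSpace_iff_inner.1 hxa (a - b))
    have h3 := tendsto_nhds_unique (h1.mono_left h𝒱) (tendsto_toWeakSpace_iff_inner.1 hxb (a - b))
    rw [← sub_eq_zero, ← inner_self_eq_zero (𝕜 := ℝ), inner_sub_right, ← h2, ← h3, sub_self]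
  obtain ⟨a, ha, hxa⟩ := hcl (Ultrafilter.of atTop) (Ultrafilter.of_le _)
  refine ⟨a, ha, (tendsto_iff_ultrafilter _ _ _).2 fun 𝒱 h𝒱 => ?_⟩
  obtain ⟨b, hb, hxb⟩ := hcl 𝒱 h𝒱
  rwa [huniq a ha b hb _ 𝒱 (Ultrafilter.of_le _) h𝒱 hxa hxb]

lemma mem_of_tendsto_toWeakSpace {s : Set H} (hconv : Convex ℝ s) (hcl : IsClosed s) {ι : Type*}
    {l : Filter ι} [l.NeBot] {x : ι → H} {a : H}
    (hx : Tendsto (fun i => toWeakSpace ℝ H (x i)) l (𝓝 (toWeakSpace ℝ H a)))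
    (hs : ∀ᶠ i in l, x i ∈ s) : a ∈ s := by
  have h1 : IsClosed (toWeakSpace ℝ H '' s) := by
    rw [← hcl.closure_eq, hconv.toWeakSpace_closure ℝ]
    exact isClosed_closure
  have h2 := h1.mem_of_tendsto hx (hs.mono fun i hi => Set.mem_image_of_mem _ hi)
  exact (toWeakSpace ℝ H).injective.mem_set_image.1 h2

/-! ### Sublevel sets and minimizers of the objective -/

section Objective

variable {R : H → EReal} {F : H → ℝ}

lemma ProperClosedConvex.convex_sublevel (hR : ProperClosedConvex R)
    (hF : ConvexOn ℝ Set.univ F) (c : ℝ) : Convex ℝ {x | R x ≤ ((c - F x : ℝ) : EReal)} := by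
  intro x hx y hy a b ha hb hab
  refine (hR.convexComb_le hx hy ha hb hab).trans (EReal.coe_le_coe_iff.2 ?_)
  have h := hF.2 (Set.mem_univ x) (Set.mem_univ y) ha hb hab
  rw [smul_eq_mul, smul_eq_mul] at h
  linear_combination h + c * hab

lemma ProperClosedConvex.isClosed_sublevel (hR : ProperClosedConvex R) (hF : Continuous F)
    (c : ℝ) : IsClosed {x | R x ≤ ((c - F x : ℝ) : EReal)} :=
  IsSeqClosed.isClosed fun _ a hu ha =>
    hR.le_of_tendsto ha (((hF.tendsto a).comp ha).const_sub c) hu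

/-- The minimizers of `R + F` form a sublevel set at a real level, the minimum `M`. -/
lemma exists_argmin_eq_sublevel (hR : ProperClosedConvex R)
    (hmin : (argmin (objective R F)).Nonempty) :
    ∃ M : ℝ, (∀ (u : H) (r : ℝ), R u ≤ r → M ≤ r + F u) ∧
      argmin (objective R F) = {x | R x ≤ ((M - F x : ℝ) : EReal)} := by
  obtain ⟨s, hs⟩ := hmin
  have hs_top : R s ≠ ⊤ := by
    intro h
    obtain ⟨x, hx⟩ := hR.exists_ne_top
    have := hs x
    rw [objective, objective, h, EReal.top_add_coe, top_le_iff, ← hR.coe_toReal hx,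
      ← EReal.coe_add] at this
    exact EReal.coe_ne_top _ this
  have hM : ∀ (u : H) (r : ℝ), R u ≤ r → (R s).toReal + F s ≤ r + F u := by
    intro u r hu
    have h1 : objective R F s ≤ ((r + F u : ℝ) : EReal) := by
      rw [EReal.coe_add]
      exact (hs u).trans (add_le_add hu le_rfl)
    rw [objective, ← hR.coe_toReal hs_top, ← EReal.coe_add] at h1
    exact EReal.coe_le_coe_iff.1 h1
  refine ⟨(R s).toReal + F s, hM, Set.ext fun a => ⟨fun ha => ?_, fun ha => ?_⟩⟩
  · have h1 := ha s
    have ha_top : R a ≠ ⊤ := by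
      intro h
      rw [objective, objective, h, EReal.top_add_coe, top_le_iff, ← hR.coe_toReal hs_top,
        ← EReal.coe_add] at h1
      exact EReal.coe_ne_top _ h1
    rw [objective, objective, ← hR.coe_toReal hs_top, ← hR.coe_toReal ha_top, ← EReal.coe_add,
      ← EReal.coe_add, EReal.coe_le_coe_iff] at h1
    change R a ≤ _
    rw [← hR.coe_toReal ha_top, EReal.coe_le_coe_iff]
    linarith
  · intro u
    by_cases hu : R u = ⊤
    · rw [objective, objective, hu, EReal.top_add_coe]; exact le_top
    have h1 := hM u _ (hR.coe_toReal hu).ge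
    calc objective R F a ≤ (((R s).toReal + F s - F a : ℝ) : EReal) + (F a : EReal) :=
          add_le_add ha le_rfl
      _ = (((R s).toReal + F s : ℝ) : EReal) := by rw [← EReal.coe_add, sub_add_cancel]
      _ ≤ (((R u).toReal + F u : ℝ) : EReal) := EReal.coe_le_coe_iff.2 h1
      _ = objective R F u := by rw [EReal.coe_add, hR.coe_toReal hu, objective]

/-- The proximal gradient estimate at the point `(1 - 1 / T) • v + (1 / T) • s`, multiplied
by `T ^ 2`. -/
lemma energy_step (hR : ProperClosedConvex R) (hF : ConvexOn ℝ Set.univ F) {L M r : ℝ}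
    (hL : 0 < L) {P y v s : H}
    (hest : ∀ (u : H) (c : ℝ), R u ≤ c →
      2 / L * ((R P).toReal + F P) + ‖P - u‖ ^ 2 ≤ 2 / L * (c + F u) + ‖y - u‖ ^ 2)
    (hv : R v ≤ r) (hs : R s ≤ ((M - F s : ℝ) : EReal)) {T : ℝ} (hT : 1 ≤ T) :
    T ^ 2 * (2 / L * ((R P).toReal + F P - M)) + ‖T • P - (T - 1) • v - s‖ ^ 2
      ≤ (T ^ 2 - T) * (2 / L * (r + F v - M)) + ‖T • y - (T - 1) • v - s‖ ^ 2 := by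
  have hT0 : 0 < T := zero_lt_one.trans_le hT
  have hb : 0 ≤ 1 / T := by positivity
  have ha : 0 ≤ 1 - 1 / T := by
    rw [sub_nonneg, div_le_one hT0]; exact hT
  have h1 := hest _ _ (hR.convexComb_le hv hs ha hb (sub_add_cancel 1 (1 / T)))
  have h2 := hF.2 (Set.mem_univ v) (Set.mem_univ s) ha hb (sub_add_cancel 1 (1 / T))
  rw [smul_eq_mul, smul_eq_mul] at h2
  have hnorm : ∀ z : H, ‖T • z - (T - 1) • v - s‖ ^ 2
      = T ^ 2 * ‖z - ((1 - 1 / T) • v + (1 / T) • s)‖ ^ 2 := by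
    intro z
    have : T • z - (T - 1) • v - s = T • (z - ((1 - 1 / T) • v + (1 / T) • s)) := by
      rw [smul_sub, smul_add, smul_smul, smul_smul, mul_sub, mul_one_div_cancel hT0.ne',
        one_smul, mul_one, sub_sub]
    rw [this, norm_smul, mul_pow, Real.norm_eq_abs, sq_abs]
  rw [hnorm, hnorm]
  have h3 := mul_le_mul_of_nonneg_left h2 (show 0 ≤ T ^ 2 * (2 / L) by positivity)
  have h4 := mul_le_mul_of_nonneg_left h1 (sq_nonneg T)
  have h5 : T ^ 2 * (1 / T) = T := by field_simp
  linear_combination h3 + h4 + (2 / L * (M - r - F v)) * h5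

end Objective

/-! ### Convergence of the iterates -/

section Iterates

variable [CompleteSpace H] {R : H → EReal} {F : H → ℝ} {γ p q r : ℝ} {x₀ : H}

lemma exists_modIterate_succ (k : ℕ) : ∃ y : H, modIterate R F γ p q r x₀ (k + 1)
    = prox γ R (y - γ • gradient F y) := ⟨_, rfl⟩

lemma modIterate_add_two (k : ℕ) {y : H}
    (hy : y = modIterate R F γ p q r x₀ (k + 1) + aSeq p q r (k + 1) •
      (modIterate R F γ p q r x₀ (k + 1) - modIterate R F γ p q r x₀ k)) :
    modIterate R F γ p q r x₀ (k + 2) = prox γ R (y - γ • gradient F y) := by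
  subst hy
  rfl

end Iterates

/-- Convergence of the objective values, rate of the increments, and convergence of the distance to
each minimizer. Minimizers are described by the sublevel set at the minimal value `M`. -/
lemma modIterate_limits [CompleteSpace H] {R : H → EReal} {F : H → ℝ} {L : ℝ≥0}
    (hR : ProperClosedConvex R) (hFconv : ConvexOn ℝ Set.univ F) (hFdiff : Differentiable ℝ F)
    (hL : 0 < L) (hFlip : LipschitzWith L (gradient F)) {p q : ℝ} (hp0 : 0 < p) (hp1 : p < 1)
    (hq : 0 ≤ q) (hpq : p ^ 2 ≤ q) (x₀ : H) {x : ℕ → H}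
    (hx : x = modIterate R F (1 / (L : ℝ)) p q 4 x₀) {M : ℝ}
    (hM : ∀ (u : H) (r : ℝ), R u ≤ r → M ≤ r + F u) {s : H}
    (hs : R s ≤ ((M - F s : ℝ) : EReal)) :
    (∀ ε > 0, ∀ᶠ k in atTop, R (x k) ≤ ((M + ε - F (x k) : ℝ) : EReal)) ∧
    Tendsto (fun n => tSeq p q 4 n * ‖x (n + 1) - x n‖) atTop (𝓝 0) ∧
    ∃ l, Tendsto (fun k => ‖x k - s‖ ^ 2) atTop (𝓝 l) := by
  have hL' : (0 : ℝ) < L := by exact_mod_cast hL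
  set t := tSeq p q 4 with ht
  have ht1 : ∀ n, 1 ≤ t n := one_le_tSeq hp0.le hq
  have ht0 : ∀ n, 0 < t n := fun n => zero_lt_one.trans_le (ht1 n)
  have hfin : ∀ n, R (x (n + 1)) ≠ ⊤ := fun n => by
    obtain ⟨y, hy⟩ := exists_modIterate_succ (R := R) (F := F) (γ := 1 / (L : ℝ)) (p := p)
      (q := q) (r := 4) (x₀ := x₀) n
    rw [hx]
    exact (proxGrad_estimate hR hFconv hFdiff hL hFlip hM y hy).1
  set y : ℕ → H := fun n => x (n + 1) + aSeq p q 4 (n + 1) • (x (n + 1) - x n) with hy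
  have hest : ∀ (n : ℕ) (u : H) (c : ℝ), R u ≤ c →
      2 / L * ((R (x (n + 2))).toReal + F (x (n + 2))) + ‖x (n + 2) - u‖ ^ 2
        ≤ 2 / L * (c + F u) + ‖y n - u‖ ^ 2 := fun n =>
    (proxGrad_estimate hR hFconv hFdiff hL hFlip hM (y n) (by
      rw [hx]; exact modIterate_add_two n (by simp only [hy, hx]))).2
  have hval : ∀ n, R (x (n + 1)) ≤ ((R (x (n + 1))).toReal : EReal) :=
    fun n => (hR.coe_toReal (hfin n)).ge
  have ha : ∀ n, t (n + 1) * aSeq p q 4 (n + 1) = t n - 1 := fun n =>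
    mul_div_cancel₀ _ (ht0 (n + 1)).ne'
  set w : ℕ → ℝ := fun n => 2 / L * ((R (x (n + 1))).toReal + F (x (n + 1)) - M) with hw
  have hw0 : ∀ n, 0 ≤ w n := fun n =>
    mul_nonneg (by positivity) (sub_nonneg.2 (hM _ _ (hval n)))
  set v : ℕ → H := fun n => t n • x (n + 1) - (t n - 1) • x n - s with hv
  obtain ⟨hwlim, hdlim, l, hl⟩ := tendsto_of_energy_estimates hp0 hp1 hq hpq
    (w := w) (d := fun n => ‖x (n + 1) - x n‖ ^ 2) (U := fun n => ‖v n‖ ^ 2) hw0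
    (fun n => sq_nonneg _) (fun n => sq_nonneg _) (fun n => by
      have h1 := energy_step hR hFconv hL' (hest n) (hval n) hs (ht1 (n + 1))
      have h2 : t (n + 1) • y n - (t (n + 1) - 1) • x (n + 1) - s = v n := by
        simp only [hy, hv, smul_add, smul_smul, ha]
        module
      rw [h2] at h1
      exact h1) (fun n => by
      have h1 := mul_le_mul_of_nonneg_left (hest n _ _ (hval n)) (sq_nonneg (t (n + 1)))
      have h2 : ‖y n - x (n + 1)‖ ^ 2 = aSeq p q 4 (n + 1) ^ 2 * ‖x (n + 1) - x n‖ ^ 2 := by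
        rw [hy, add_sub_cancel_left, norm_smul, mul_pow, Real.norm_eq_abs, sq_abs]
      have h3 : (t n - 1) ^ 2 = t (n + 1) ^ 2 * aSeq p q 4 (n + 1) ^ 2 := by
        rw [← ha, mul_pow]
      rw [h2] at h1
      change t (n + 1) ^ 2 * (w (n + 1) + ‖x (n + 2) - x (n + 1)‖ ^ 2)
        ≤ t (n + 1) ^ 2 * w n + (t n - 1) ^ 2 * ‖x (n + 1) - x n‖ ^ 2
      rw [h3]
      simp only [hw]
      linear_combination h1)
  rw [← ht] at hwlim hdlim
  have hincr : Tendsto (fun n => t n * ‖x (n + 1) - x n‖) atTop (𝓝 0) := by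
    have h := (Real.continuous_sqrt.tendsto 0).comp hdlim
    rw [Real.sqrt_zero] at h
    refine h.congr fun n => ?_
    rw [Function.comp_apply, ← mul_pow, Real.sqrt_sq (mul_nonneg (ht0 n).le (norm_nonneg _))]
  refine ⟨fun ε hε => ?_, hincr, l, ?_⟩
  · have h1 : Tendsto w atTop (𝓝 0) := squeeze_zero hw0
      (fun n => le_mul_of_one_le_left (hw0 n) (one_le_pow₀ (ht1 n))) hwlim
    have h2 : ∀ᶠ n in atTop, R (x (n + 1)) ≤ ((M + ε - F (x (n + 1)) : ℝ) : EReal) := by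
      filter_upwards [h1.eventually (gt_mem_nhds (show 0 < 2 / L * ε by positivity))] with n hn
      have := lt_of_mul_lt_mul_left hn (by positivity)
      exact (hval n).trans (EReal.coe_le_coe_iff.2 (by linarith))
    have h3 := tendsto_sub_atTop_nat 1 |>.eventually h2
    filter_upwards [h3, eventually_ge_atTop 1] with k hk hk1
    rwa [Nat.sub_add_cancel hk1] at hk
  · -- `v n` and `x n - s` differ by `t n • (x (n + 1) - x n)`, which tends to zero.
    have h1 : Tendsto (fun n => ‖v n‖) atTop (𝓝 √l) :=
      ((Real.continuous_sqrt.tendsto l).comp hl).congr fun n => Real.sqrt_sq (norm_nonneg _)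
    have h2 : Tendsto (fun n => ‖x n - s‖ - ‖v n‖) atTop (𝓝 0) := by
      refine squeeze_zero_norm (fun n => ?_) hincr
      refine (abs_norm_sub_norm_le _ _).trans (le_of_eq ?_)
      have : x n - s - v n = -(t n • (x (n + 1) - x n)) := by
        simp only [hv]
        module
      rw [this, norm_neg, norm_smul, Real.norm_of_nonneg (ht0 n).le]
    have h3 := (h2.add h1).pow 2
    have hl0 : 0 ≤ l := ge_of_tendsto' hl fun n => sq_nonneg _
    simpa [Real.sq_sqrt hl0] using h3

end FISTA

theorem mainTheorem3 {H : Type*} [NormedAddCommGroup H] [InnerProductSpace ℝ H]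
    [CompleteSpace H] (R : H → EReal) (F : H → ℝ) (L : ℝ≥0)
    (hR : FISTA.ProperClosedConvex R)
    (hFconv : ConvexOn ℝ Set.univ F) (hFdiff : Differentiable ℝ F)
    (hL : 0 < L) (hFlip : LipschitzWith L (gradient F))
    (hmin : (FISTA.argmin (FISTA.objective R F)).Nonempty)
    (p q : ℝ) (hp0 : 0 < p) (hp1 : p < 1) (hq : 0 < q) (hpq : p ^ 2 ≤ q) (x₀ : H) :
    (∃ xstar ∈ FISTA.argmin (FISTA.objective R F),
      Tendsto (fun k : ℕ => toWeakSpace ℝ H (FISTA.modIterate R F (1 / (L : ℝ)) p q 4 x₀ k))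
        atTop (𝓝 (toWeakSpace ℝ H xstar))) ∧
    (fun k : ℕ => ‖FISTA.modIterate R F (1 / (L : ℝ)) p q 4 x₀ (k + 1) -
        FISTA.modIterate R F (1 / (L : ℝ)) p q 4 x₀ k‖)
      =o[atTop] (fun k : ℕ => 1 / ((k + 1 : ℕ) : ℝ)) := by
  obtain ⟨M, hM, hargmin⟩ := FISTA.exists_argmin_eq_sublevel hR hmin
  have hlim := fun s (hs : R s ≤ ((M - F s : ℝ) : EReal)) =>
    FISTA.modIterate_limits hR hFconv hFdiff hL hFlip hp0 hp1 hq.le hpq x₀ rfl hM hs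
  rw [hargmin] at hmin ⊢
  obtain ⟨s, hs⟩ := hmin
  obtain ⟨hval, hincr, -⟩ := hlim s hs
  refine ⟨FISTA.exists_tendsto_toWeakSpace_of_opial ⟨s, hs⟩ (fun a ha => (hlim a ha).2.2)
    fun 𝒰 a h𝒰 ha => ?_, ?_⟩
  · have hmem : ∀ ε > 0, R a ≤ ((M + ε - F a : ℝ) : EReal) := fun ε hε =>
      FISTA.mem_of_tendsto_toWeakSpace (hR.convex_sublevel hFconv (M + ε))
        (hR.isClosed_sublevel hFdiff.continuous (M + ε)) ha (h𝒰 (hval ε hε))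
    refine EReal.le_of_forall_lt_iff_le.1 fun z hz => ?_
    have hz' : M - F a < z := by exact_mod_cast hz
    refine (hmem (z - (M - F a)) (by linarith)).trans (EReal.coe_le_coe_iff.2 (by linarith))
  · rw [isLittleO_iff_tendsto' (Eventually.of_forall fun k h => absurd h (by positivity))]
    -- `t k` grows at least like `(k + 1) * (p / 2)`.
    have hbound : Tendsto (fun k => 2 / p * (FISTA.tSeq p q 4 k *
        ‖FISTA.modIterate R F (1 / (L : ℝ)) p q 4 x₀ (k + 1) -
          FISTA.modIterate R F (1 / (L : ℝ)) p q 4 x₀ k‖)) atTop (𝓝 0) := by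
      simpa using hincr.const_mul (2 / p)
    refine squeeze_zero (fun k => by positivity) (fun k => ?_) hbound
    rw [div_div_eq_mul_div, div_one, mul_comm, ← mul_assoc]
    refine mul_le_mul_of_nonneg_right ?_ (norm_nonneg _)
    have h := FISTA.le_tSeq hp0.le hq.le k
    rw [div_mul_eq_mul_div, le_div_iff₀ hp0]
    push_cast
    linarith
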